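/- Throughout, matrices are complex. For a square matrix $M$ with nonzero entries, $M^{(-)}$ denotes its Schur (entrywise) inverse, and $\circ$ denotes the Schur (entrywise) product. A $v\times v$ matrix $M$ with nonzero entries is type II if $M (M^{(-)})^T = vI$. For $n\times n$ matrices $A,B$, let $X_A(M)=AM$ and $\Delta_B(M)=B\circ M$ for $M\in \mathrm{Mat}_n(\mathbb C)$. The pair $(A,B)$ is a one-sided Jones pair if $X_A$ and $\Delta_B$ are invertible and $X_A\Delta_BX_A=\Delta_BX_A\Delta_B$; it is a Jones pair if $(A,B)$ and $(A,B^T)$ are one-sided Jones pairs; a Jones pair $(A,B)$ is invertible if moreover all entries of $A$ are nonzero and $B$ is invertible. Let $N_{A,B}$ be the algebra of matrices $R$ for which every vector $Ae_i\circ Be_j$ is an eigenvector; write $\Theta_{A,B}(R)$ for the matrix $S$ with $R(Ae_i\circ Be_j)=S_{ij}(Ae_i\circ Be_j)$ for all $i,j$. For $A$ with nonzero entries put $N_A=N_{A,A^{(-)}}$ (the Nomura algebra of $A$) and $\Theta_A=\Theta_{A,A^{(-)}}$. The basis of principal idempotents of such an algebra is its basis consisting of mutually orthogonal idempotents with sum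 $I$; the basis of Schur idempotents is its basis consisting of matrices that are mutually orthogonal idempotents for the Schur product, with sum the all-ones matrix $J$. (These bases are unique up to order when they exist.) **Theorem.** Let $(A,B)$ be an $n\times n$ invertible Jones pair, let $C$ be an invertible diagonal matrix with $A^T=C^{-2}AC^2$, and let $$W=\begin{pmatrix}A^T&-A^T\\ (B^{(-)})^TC&(B^{(-)})^TC\end{pmatrix}.$$ Then $W$ is type II, $\dim N_A=\dim N_{A,B}=:r$, and $N_A$ and $N_{A,B}$ have bases of principal idempotents $\{E_0,\dots,E_{r-1}\}$ and $\{F_0,\dots,F_{r-1}\}$, respectively. For these, the $2r$ matrices $$\begin{pmatrix}\Theta_A(E_i)&0\\0&\Theta_B(E_i)^T\end{pmatrix},\qquad \begin{pmatrix}0&\Theta_{A,B}(F_j)\\ \Theta_{A,B}(C^2F_j^TC^{-2})^T&0\end{pmatrix}\qquad(0\le i,j\le r-1)$$ form the basis of Schur idempotents of $N_W$, and the $2r$ matrices $$\frac12\begin{pmatrix}E_i^T&E_i^T\\E_i^T&E_i^T\end{pmatrix},\qquad \frac12\begin{pmatrix}CF_j^TC^{-1}&-CF_j^TC^{-1}\\-CF_j^TC^{-1}&CF_j^TC^{-1}\end{pmatrix}\qquad(0\le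 i,j\le r-1)$$ form the basis of principal idempotents of $N_{W^T}$. Consequently $\dim N_W=\dim N_{W^T}=2\dim N_A$. -/

import Mathlib

open scoped Matrix

namespace JonesPairs

variable {V ι : Type*} [Fintype V] [DecidableEq V] [Fintype ι]

/-- The operator `X_A : M ↦ A M` on square matrices. -/
def opX (A : Matrix V V ℂ) : Module.End ℂ (Matrix V V ℂ) :=
  LinearMap.mulLeft ℂ A

/-- The operator `Δ_B : M ↦ B ∘ M` (Schur, i.e. entrywise, multiplication by `B`). -/
def opD (B : Matrix V V ℂ) : Module.End ℂ (Matrix V V ℂ) where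
  toFun M := B ⊙ M
  map_add' M N := Matrix.hadamard_add B M N
  map_smul' c M := Matrix.hadamard_smul B M c

/-- `(A, B)` is a one-sided Jones pair: `X_A` and `Δ_B` are invertible and satisfy the
braid relation `X_A Δ_B X_A = Δ_B X_A Δ_B`. -/
def IsOneSidedJonesPair (A B : Matrix V V ℂ) : Prop :=
  IsUnit (opX A) ∧ IsUnit (opD B) ∧ opX A * opD B * opX A = opD B * opX A * opD B

/-- `(A, B)` is a Jones pair: both `(A, B)` and `(A, Bᵀ)` are one-sided Jones pairs. -/
def IsJonesPair (A B : Matrix V V ℂ) : Prop :=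
  IsOneSidedJonesPair A B ∧ IsOneSidedJonesPair A Bᵀ

/-- The Jones pair `(A, B)` is invertible: moreover `A` is Schur invertible and `B` is
invertible. -/
def IsInvertibleJonesPair (A B : Matrix V V ℂ) : Prop :=
  IsJonesPair A B ∧ (∀ i j, A i j ≠ 0) ∧ IsUnit B

/-- The Schur (entrywise) inverse `A^{(-)}`. -/
noncomputable def schurInv (A : Matrix V V ℂ) : Matrix V V ℂ :=
  A.map fun z => z⁻¹

/-- `A` is type II: its entries are nonzero and `A (A^{(-)})ᵀ = |V| I`. -/
def IsTypeII (A : Matrix V V ℂ) : Prop :=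
  (∀ i j, A i j ≠ 0) ∧ A * (schurInv A)ᵀ = (Fintype.card V : ℂ) • (1 : Matrix V V ℂ)

/-- The Schur product `A e_i ∘ B e_j` of column `i` of `A` and column `j` of `B`. -/
def eigVec (A B : Matrix V V ℂ) (i j : V) : V → ℂ :=
  fun k => A k i * B k j

/-- `S` records eigenvalues of `R`: `R (A e_i ∘ B e_j) = S_{ij} (A e_i ∘ B e_j)`. -/
def IsEigenvalueMatrix (A B R S : Matrix V V ℂ) : Prop :=
  ∀ i j, R *ᵥ eigVec A B i j = S i j • eigVec A B i j

/-- The algebra `N_{A,B}` of matrices having all vectors `A e_i ∘ B e_j` as eigenvectors. -/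
def nomura₂ (A B : Matrix V V ℂ) : Subalgebra ℂ (Matrix V V ℂ) where
  carrier := {R | ∃ S, IsEigenvalueMatrix A B R S}
  mul_mem' := by
    rintro R R' ⟨S, hS⟩ ⟨S', hS'⟩
    refine ⟨S ⊙ S', fun i j => ?_⟩
    rw [← Matrix.mulVec_mulVec, hS' i j, Matrix.mulVec_smul, hS i j, smul_smul,
      Matrix.hadamard_apply, mul_comm]
  add_mem' := by
    rintro R R' ⟨S, hS⟩ ⟨S', hS'⟩
    refine ⟨S + S', fun i j => ?_⟩
    rw [Matrix.add_mulVec, hS i j, hS' i j, Matrix.add_apply, add_smul]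
  algebraMap_mem' c := by
    refine ⟨Matrix.of fun _ _ => c, fun i j => ?_⟩
    rw [Algebra.algebraMap_eq_smul_one, Matrix.smul_mulVec, Matrix.one_mulVec, Matrix.of_apply]

/-- The Nomura algebra `N_A = N_{A, A^{(-)}}`. -/
noncomputable def nomura (A : Matrix V V ℂ) : Subalgebra ℂ (Matrix V V ℂ) :=
  nomura₂ A (schurInv A)

open Classical in
/-- `Θ_{A,B}(R)`, the matrix of eigenvalues of `R ∈ N_{A,B}`. It is unique as soon as no vector
`A e_i ∘ B e_j` vanishes; the value is `0` outside `N_{A,B}`. -/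
noncomputable def Theta₂ (A B R : Matrix V V ℂ) : Matrix V V ℂ :=
  if h : ∃ S, IsEigenvalueMatrix A B R S then h.choose else 0

/-- `Θ_A = Θ_{A, A^{(-)}}`. -/
noncomputable def Theta (A R : Matrix V V ℂ) : Matrix V V ℂ :=
  Theta₂ A (schurInv A) R

/-- `E` is the basis of principal idempotents of the algebra `N`: a basis of `N` made of
mutually orthogonal idempotents with sum `I`. -/
def IsPrincipalIdempotentBasis (N : Subalgebra ℂ (Matrix V V ℂ)) (E : ι → Matrix V V ℂ) : Prop :=
  LinearIndependent ℂ E ∧ Submodule.span ℂ (Set.range E) = Subalgebra.toSubmodule N ∧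
    (∀ i, E i * E i = E i) ∧ (∀ i j, i ≠ j → E i * E j = 0) ∧ ∑ i, E i = 1

/-- `E` is the basis of Schur idempotents of `N`: a basis of `N` made of idempotents for the
Schur product that are mutually orthogonal for it, with sum the all-ones matrix `J`. -/
def IsSchurIdempotentBasis (N : Subalgebra ℂ (Matrix V V ℂ)) (E : ι → Matrix V V ℂ) : Prop :=
  LinearIndependent ℂ E ∧ Submodule.span ℂ (Set.range E) = Subalgebra.toSubmodule N ∧
    (∀ i, E i ⊙ E i = E i) ∧ (∀ i j, i ≠ j → E i ⊙ E j = 0) ∧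
    ∑ i, E i = Matrix.of fun _ _ => 1

/-- The block matrix `W = [[Aᵀ, -Aᵀ], [(B^{(-)})ᵀ C, (B^{(-)})ᵀ C]]`. -/
noncomputable def matrixW (A B C : Matrix V V ℂ) : Matrix (V ⊕ V) (V ⊕ V) ℂ :=
  Matrix.fromBlocks Aᵀ (-Aᵀ) ((schurInv B)ᵀ * C) ((schurInv B)ᵀ * C)

end JonesPairs

open JonesPairs

-- Write a_i, b_i for the rows of A, B, take quotients entrywise, and let n be the size. When B is
-- type II, "S is the eigenvalue matrix of R" for (A, B) becomes S(b_j/b_i) = n R_ji (a_i/a_j) for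
-- all i, j (`isEigenvalueMatrix_iff_dual`). The columns of W are (±a_i, c_i/b_i), so their
-- quotients are (±a_i/a_j, (c_i/c_j) b_j/b_i), both signs occurring for each i, j. Adding and
-- subtracting the eigenvalue equations of an element of N_W over the two signs separates its
-- blocks: the upper left is Θ_A(E) with E ∈ N_A, the upper right Θ_{A,B}(F) with F ∈ N_{A,B}. The
-- eigenvalues are n(E_ji ± (c_i/c_j) F_ji), and they determine the lower blocks because W is type
-- II (`exists_of_isEigenvalueMatrix_matrixW`).
--
-- Conversely, every pair (E, F) occurs once E ∈ N_B and C²FᵀC⁻² ∈ N_{A,B}. Both follow from A ∈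
-- N_{A,B} with Θ_{A,B}(A) = B: Schur multiplication by Aᵀ identifies N_{A,B} with N_A, and by
-- symmetry with N_B (`mem_nomura₂_iff_hadamard_mem_nomura`); under it the condition on C turns F ↦
-- C²FᵀC⁻² into transposition on N_A.
--
-- Thus N_W is parametrized by N_A ⊕ N_{A,B}. The parametrization turns products into Schur
-- products, which gives the Schur idempotents; Nomura duality, under which Θ_W maps N_W onto
-- N_{Wᵀ}, gives the principal ones.

namespace JonesPairs

set_option linter.unusedSectionVars false

-- Type II matrices and duality between a matrix and its eigenvalue matrix

section Duality

variable {V : Type*} [Fintype V] [DecidableEq V] {A B R S : Matrix V V ℂ}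

@[simp]
lemma schurInv_apply (A : Matrix V V ℂ) (i j : V) : schurInv A i j = (A i j)⁻¹ := rfl

lemma schurInv_schurInv (A : Matrix V V ℂ) : schurInv (schurInv A) = A := by
  ext i j; simp

lemma isEigenvalueMatrix_iff : IsEigenvalueMatrix A B R S ↔
    ∀ i j k, ∑ l, R k l * (A l i * B l j) = S i j * (A k i * B k j) := by
  simp only [IsEigenvalueMatrix, funext_iff, Matrix.mulVec, dotProduct, eigVec, Pi.smul_apply,
    smul_eq_mul]

lemma IsEigenvalueMatrix.swap (h : IsEigenvalueMatrix A B R S) :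
    IsEigenvalueMatrix B A R Sᵀ := by
  rw [isEigenvalueMatrix_iff] at h ⊢
  intro i j k
  simpa only [mul_comm (B _ i), Matrix.transpose_apply] using h j i k

lemma isTypeII_iff : IsTypeII A ↔ (∀ i j, A i j ≠ 0) ∧
    ∀ i j, ∑ m, A i m * (A j m)⁻¹ = if i = j then (Fintype.card V : ℂ) else 0 := by
  simp [IsTypeII, ← Matrix.ext_iff, Matrix.mul_apply, Matrix.one_apply]

lemma IsTypeII.row_sum (h : IsTypeII A) (i j : V) :
    ∑ m, A i m * (A j m)⁻¹ = if i = j then (Fintype.card V : ℂ) else 0 :=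
  (isTypeII_iff.1 h).2 i j

/-- Division by |V| is always done entrywise, where an index is at hand, so the empty index type
needs no separate treatment. -/
lemma card_ne_zero_of_mem (i : V) : (Fintype.card V : ℂ) ≠ 0 := by
  have : Nonempty V := ⟨i⟩
  exact_mod_cast Fintype.card_ne_zero

lemma IsTypeII.mul_transpose_schurInv (h : IsTypeII A) :
    A * ((Fintype.card V : ℂ)⁻¹ • (schurInv A)ᵀ) = 1 := by
  rw [Matrix.mul_smul, h.2, smul_smul]
  ext i j
  simp [inv_mul_cancel₀ (card_ne_zero_of_mem i)]

lemma IsTypeII.transpose (h : IsTypeII A) : IsTypeII Aᵀ := by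
  refine ⟨fun i j => h.1 j i, ?_⟩
  have h1 := mul_eq_one_comm.1 h.mul_transpose_schurInv
  have h2 := congrArg Matrix.transpose h1
  rw [Matrix.transpose_mul, Matrix.transpose_smul, Matrix.transpose_transpose,
    Matrix.mul_smul, Matrix.transpose_one] at h2
  have h3 : (schurInv Aᵀ)ᵀ = schurInv A := by ext; simp
  rw [h3, ← h2]
  ext i j
  simp [mul_inv_cancel_left₀ (card_ne_zero_of_mem i)]

lemma IsTypeII.col_sum (h : IsTypeII A) (i j : V) :
    ∑ m, A m i * (A m j)⁻¹ = if i = j then (Fintype.card V : ℂ) else 0 :=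
  h.transpose.row_sum i j

lemma IsTypeII.schurInv (h : IsTypeII A) : IsTypeII (schurInv A) := by
  refine isTypeII_iff.2 ⟨fun i j => inv_ne_zero (h.1 i j), fun i j => ?_⟩
  simpa [mul_comm, eq_comm] using h.row_sum j i

/-- A matrix is determined by its products with the quotients of the rows of a type II matrix. -/
lemma IsTypeII.sum_inj (h : IsTypeII A) {f g : V → ℂ} (i : V)
    (hfg : ∀ j, ∑ m, f m * (A j m * (A i m)⁻¹) = ∑ m, g m * (A j m * (A i m)⁻¹)) : f = g := by
  -- Column orthogonality recovers f from these sums.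
  have h1 : ∀ f : V → ℂ, ∀ k, ∑ j, (∑ m, f m * (A j m * (A i m)⁻¹)) * (A j k)⁻¹
      = Fintype.card V * (f k * (A i k)⁻¹) := by
    intro f k
    simp_rw [Finset.sum_mul]
    rw [Finset.sum_comm]
    have : ∀ m, ∑ j, f m * (A j m * (A i m)⁻¹) * (A j k)⁻¹
        = f m * (A i m)⁻¹ * ∑ j, A j m * (A j k)⁻¹ := by
      intro m; rw [Finset.mul_sum]; exact Finset.sum_congr rfl fun _ _ => by ring
    simp_rw [this, h.col_sum]
    simp [mul_comm]
  ext k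
  have h2 := h1 f k
  simp_rw [hfg, h1 g k] at h2
  have h3 := mul_left_cancel₀ (card_ne_zero_of_mem k) h2
  exact (mul_right_cancel₀ (inv_ne_zero (h.1 i k)) h3).symm

/-- The eigenvalue relation, read as a statement on the action of the matrix of eigenvalues on
quotients of rows. -/
lemma isEigenvalueMatrix_iff_dual (hA : ∀ i j, A i j ≠ 0) (hB : IsTypeII B) :
    IsEigenvalueMatrix A B R S ↔ ∀ i j k, ∑ m, S k m * (B j m * (B i m)⁻¹)
      = Fintype.card V * R j i * (A i k * (A j k)⁻¹) := by
  -- Summing over m against 1 / B i m leaves only l = i, by row orthogonality of B.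
  have key : ∀ i j k, ∑ m, (∑ l, R j l * (A l k * B l m)) * (B i m)⁻¹
      = Fintype.card V * R j i * A i k := by
    intro i j k
    simp_rw [Finset.sum_mul]
    rw [Finset.sum_comm]
    have : ∀ l, ∑ m, R j l * (A l k * B l m) * (B i m)⁻¹
        = R j l * A l k * ∑ m, B l m * (B i m)⁻¹ := by
      intro l; rw [Finset.mul_sum]; exact Finset.sum_congr rfl fun _ _ => by ring
    simp_rw [this, hB.row_sum]
    simp; ring
  have key' : ∀ i j k, ∑ m, S k m * (A j k * B j m) * (B i m)⁻¹
      = A j k * ∑ m, S k m * (B j m * (B i m)⁻¹) := by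
    intro i j k
    rw [Finset.mul_sum]; exact Finset.sum_congr rfl fun _ _ => by ring
  rw [isEigenvalueMatrix_iff]
  constructor
  · intro h i j k
    have h1 := key i j k
    simp_rw [h k _ j, key'] at h1
    rw [← mul_right_inj' (hA j k), h1]
    field_simp [hA j k]
  · intro h k m j
    -- For the converse, the two sides are compared as vectors in m: they have the same sums against
    -- the quotients of rows of `schurInv B`, which separate vectors.
    have h1 : (fun m => (∑ l, R j l * (A l k * B l m)) * (B j m)⁻¹)
        = fun m => S k m * A j k := by
      refine hB.schurInv.sum_inj j fun i => ?_
      have e1 := key i j k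
      have e2 := key' i j k
      rw [h i j k] at e2
      have e3 : A j k * (Fintype.card V * R j i * (A i k * (A j k)⁻¹))
          = Fintype.card V * R j i * A i k := by field_simp [hA j k]
      rw [e3, ← e1] at e2
      have hBj := hB.1 j
      refine Eq.trans (Finset.sum_congr rfl fun m _ => ?_)
        (e2.symm.trans (Finset.sum_congr rfl fun m _ => ?_))
      · simp only [schurInv_apply, inv_inv]; field_simp [hBj m]
      · simp only [schurInv_apply, inv_inv]; field_simp [hBj m]
    have h2 := congrFun h1 m
    rw [← mul_left_inj' (inv_ne_zero (hB.1 j m)), h2]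
    field_simp [hB.1 j m]

/-- The matrix of eigenvalues is unique. -/
lemma IsEigenvalueMatrix.unique {S' : Matrix V V ℂ} (hA : ∀ i j, A i j ≠ 0)
    (hB : ∀ i j, B i j ≠ 0) (h : IsEigenvalueMatrix A B R S) (h' : IsEigenvalueMatrix A B R S') :
    S = S' := by
  rw [isEigenvalueMatrix_iff] at h h'
  ext i j
  exact mul_right_cancel₀ (mul_ne_zero (hA i i) (hB i j)) ((h i j i).symm.trans (h' i j i))

/-- An element of `N_{A,B}` is determined by its matrix of eigenvalues. -/
lemma IsEigenvalueMatrix.unique_left {R' : Matrix V V ℂ} (hA : ∀ i j, A i j ≠ 0)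
    (hB : IsTypeII B) (h : IsEigenvalueMatrix A B R S) (h' : IsEigenvalueMatrix A B R' S) :
    R = R' := by
  rw [isEigenvalueMatrix_iff_dual hA hB] at h h'
  ext j i
  have e := (h i j i).symm.trans (h' i j i)
  exact mul_left_cancel₀ (card_ne_zero_of_mem i)
    (mul_right_cancel₀ (mul_ne_zero (hA i i) (inv_ne_zero (hA j i))) e)

lemma IsEigenvalueMatrix.mul {R' S' : Matrix V V ℂ} (h : IsEigenvalueMatrix A B R S)
    (h' : IsEigenvalueMatrix A B R' S') : IsEigenvalueMatrix A B (R * R') (S ⊙ S') := by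
  intro i j
  rw [← Matrix.mulVec_mulVec, h' i j, Matrix.mulVec_smul, h i j, smul_smul,
    Matrix.hadamard_apply, mul_comm]

lemma IsEigenvalueMatrix.one :
    IsEigenvalueMatrix A B (1 : Matrix V V ℂ) (Matrix.of fun _ _ => 1) := by
  intro i j
  simp

lemma IsEigenvalueMatrix.zero : IsEigenvalueMatrix A B (0 : Matrix V V ℂ) 0 := by
  intro i j
  simp

lemma IsEigenvalueMatrix.add {R' S' : Matrix V V ℂ} (h : IsEigenvalueMatrix A B R S)
    (h' : IsEigenvalueMatrix A B R' S') : IsEigenvalueMatrix A B (R + R') (S + S') := by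
  intro i j
  rw [Matrix.add_mulVec, h i j, h' i j, Matrix.add_apply, add_smul]

lemma IsEigenvalueMatrix.smul (h : IsEigenvalueMatrix A B R S) (c : ℂ) :
    IsEigenvalueMatrix A B (c • R) (c • S) := by
  intro i j
  rw [Matrix.smul_mulVec, h i j, Matrix.smul_apply, smul_smul, smul_eq_mul]

lemma IsEigenvalueMatrix.sum {κ : Type*} {s : Finset κ} {E T : κ → Matrix V V ℂ}
    (h : ∀ q ∈ s, IsEigenvalueMatrix A B (E q) (T q)) :
    IsEigenvalueMatrix A B (∑ q ∈ s, E q) (∑ q ∈ s, T q) := by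
  intro i j
  rw [Matrix.sum_mulVec, Matrix.sum_apply, Finset.sum_smul]
  exact Finset.sum_congr rfl fun q hq => h q hq i j

lemma Theta₂_spec (h : R ∈ nomura₂ A B) : IsEigenvalueMatrix A B R (Theta₂ A B R) := by
  have h' : ∃ S, IsEigenvalueMatrix A B R S := h
  rw [Theta₂, dif_pos h']
  exact h'.choose_spec

lemma Theta₂_eq (hA : ∀ i j, A i j ≠ 0) (hB : ∀ i j, B i j ≠ 0)
    (h : IsEigenvalueMatrix A B R S) : Theta₂ A B R = S :=
  (Theta₂_spec ⟨S, h⟩).unique hA hB h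

/-- Nomura's duality between the algebras of `A` and of `Aᵀ`. -/
lemma isEigenvalueMatrix_nomura_iff (hA : IsTypeII A) :
    IsEigenvalueMatrix A (schurInv A) R S ↔
      IsEigenvalueMatrix Aᵀ (schurInv Aᵀ) S ((Fintype.card V : ℂ) • Rᵀ) := by
  rw [isEigenvalueMatrix_iff_dual hA.1 hA.schurInv, isEigenvalueMatrix_iff]
  simp [mul_comm (A _ _)⁻¹]

/-- Duality for pairs commutes with transposition. -/
lemma IsEigenvalueMatrix.transpose (hA : ∀ i j, A i j ≠ 0) (hB : IsTypeII B)
    (h : IsEigenvalueMatrix A B R S) :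
    IsEigenvalueMatrix (schurInv A) (schurInv B) Rᵀ S := by
  rw [isEigenvalueMatrix_iff_dual hA hB] at h
  rw [isEigenvalueMatrix_iff_dual (A := schurInv A) (fun i j => inv_ne_zero (hA i j)) hB.schurInv]
  intro i j k
  simpa [mul_comm (A _ _)⁻¹, mul_comm (B _ _)⁻¹] using h j i k

lemma IsEigenvalueMatrix.nomura_transpose (hA : IsTypeII A)
    (h : IsEigenvalueMatrix A (schurInv A) R S) :
    IsEigenvalueMatrix A (schurInv A) Rᵀ Sᵀ := by
  have := (h.transpose hA.1 hA.schurInv).swap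
  rwa [schurInv_schurInv] at this

lemma transpose_mem_nomura (hA : IsTypeII A) (h : R ∈ nomura A) : Rᵀ ∈ nomura A := by
  obtain ⟨S, hS⟩ := h
  exact ⟨Sᵀ, hS.nomura_transpose hA⟩

/-- If a Schur invertible `G ∈ N_{A,B}` has an invertible matrix of eigenvalues, then
`N_{A,B}` consists of the Schur quotients of the elements of `N_A` by `Gᵀ`. -/
lemma mem_nomura₂_iff_hadamard_mem_nomura {G T : Matrix V V ℂ} (hA : IsTypeII A)
    (hB : IsTypeII B) (hG : ∀ i j, G i j ≠ 0) (hT : IsUnit T)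
    (h : IsEigenvalueMatrix A B G T) : R ∈ nomura₂ A B ↔ R ⊙ Gᵀ ∈ nomura A := by
  have hGT := (isEigenvalueMatrix_iff_dual hB.1 hA).1 h.swap
  -- Tᵀ carries a_j/a_i to a multiple of b_i/b_j, and the eigenvalue matrix of R carries that back
  -- to a multiple of a_j/a_i. So S Tᵀ acts diagonally on quotients of rows of A, the scalars being
  -- multiplied entrywise.
  have hmul : ∀ (S : Matrix V V ℂ) i j k, ∑ m, (S * Tᵀ) k m * (A j m * (A i m)⁻¹)
      = Fintype.card V * G j i * ∑ l, S k l * (B i l * (B j l)⁻¹) := by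
    intro S i j k
    simp_rw [Matrix.mul_apply, Finset.sum_mul]
    rw [Finset.sum_comm, Finset.mul_sum]
    refine Finset.sum_congr rfl fun l _ => ?_
    have := hGT i j l
    simp_rw [mul_assoc (S k l)]
    rw [← Finset.mul_sum, this]
    ring
  constructor
  · rintro ⟨S, hS⟩
    rw [isEigenvalueMatrix_iff_dual hA.1 hB] at hS
    refine ⟨(Fintype.card V : ℂ)⁻¹ • (S * Tᵀ), ?_⟩
    rw [isEigenvalueMatrix_iff_dual hA.1 hA.schurInv]
    intro i j k
    have := hmul S j i k
    rw [hS i j k] at this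
    have hn := card_ne_zero_of_mem i
    simp only [Matrix.smul_apply, smul_eq_mul, schurInv_apply, inv_inv, Matrix.hadamard_apply,
      Matrix.transpose_apply, mul_assoc, mul_comm (A _ _)⁻¹] at this ⊢
    rw [← Finset.mul_sum, this]
    field_simp
  · rintro ⟨S, hS⟩
    rw [isEigenvalueMatrix_iff_dual hA.1 hA.schurInv] at hS
    refine ⟨(Fintype.card V : ℂ) • (S * (Tᵀ)⁻¹), ?_⟩
    rw [isEigenvalueMatrix_iff_dual hA.1 hB]
    intro i j k
    have := hmul (S * (Tᵀ)⁻¹) j i k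
    have hT' : IsUnit (Tᵀ).det := by
      rw [Matrix.det_transpose]; exact (Matrix.isUnit_iff_isUnit_det T).1 hT
    rw [Matrix.mul_assoc, Matrix.nonsing_inv_mul _ hT', Matrix.mul_one] at this
    have h2 := hS i j k
    simp only [schurInv_apply, inv_inv, mul_comm (A _ _)⁻¹, Matrix.hadamard_apply,
      Matrix.transpose_apply] at h2
    rw [h2] at this
    have hn := card_ne_zero_of_mem i
    simp only [Matrix.smul_apply, smul_eq_mul, mul_assoc] at this ⊢
    rw [← Finset.mul_sum]
    refine mul_left_cancel₀ (hG i j) ?_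
    rw [mul_left_comm, ← this]
    ring

end Duality

-- Invertible Jones pairs: type II property and N_{A,B} ≅ N_A = N_B

section JonesPair

variable {V : Type*} [Fintype V] [DecidableEq V] {A B : Matrix V V ℂ}

lemma IsOneSidedJonesPair.isUnit_left (h : IsOneSidedJonesPair A B) : IsUnit A := by
  obtain ⟨M, hM⟩ := ((Module.End.isUnit_iff _).1 h.1).2 1
  exact IsUnit.of_mul_eq_one M hM

lemma IsOneSidedJonesPair.right_ne_zero (h : IsOneSidedJonesPair A B) (i j : V) :
    B i j ≠ 0 := by
  intro hij
  have h1 : opD B (Matrix.single i j 1) = opD B 0 := by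
    ext k l
    simp only [opD, LinearMap.coe_mk, AddHom.coe_mk, Matrix.hadamard_apply, Matrix.single_apply,
      Matrix.zero_apply, mul_zero]
    split_ifs with hkl
    · rw [← hkl.1, ← hkl.2, hij, zero_mul]
    · simp
  have h2 := ((Module.End.isUnit_iff _).1 h.2.1).1 h1
  simpa using congrFun (congrFun h2 i) j

/-- This is the braid relation evaluated on matrix units. -/
lemma IsOneSidedJonesPair.isEigenvalueMatrix (h : IsOneSidedJonesPair A B) :
    IsEigenvalueMatrix A B A B := by
  rw [isEigenvalueMatrix_iff]
  intro i j k
  have h1 := congrFun (congrFun (LinearMap.congr_fun h.2.2 (Matrix.single i j 1)) k) j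
  simp only [opX, opD, Module.End.mul_apply, LinearMap.mulLeft_apply, LinearMap.coe_mk,
    AddHom.coe_mk, Matrix.mul_apply, Matrix.hadamard_apply, Matrix.single_apply] at h1
  simp only [and_true, mul_ite, mul_one, mul_zero, Finset.sum_ite_eq, Finset.mem_univ,
    if_true] at h1
  rw [show B i j * (A k i * B k j) = B k j * (A k i * B i j) by ring, ← h1]
  exact Finset.sum_congr rfl fun _ _ => by ring

/-- The columns of `B` all have sum `tr A`. -/
lemma IsOneSidedJonesPair.col_sum (h : IsOneSidedJonesPair A B) (j : V) :
    ∑ i, B i j = A.trace := by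
  have hA := h.isUnit_left
  have hD : IsUnit (Matrix.diagonal fun k => B k j) := by
    rw [Matrix.isUnit_diagonal, Pi.isUnit_iff]
    exact fun k => (h.right_ne_zero k j).isUnit
  obtain ⟨U, hU⟩ := hD.mul hA
  have h1 := isEigenvalueMatrix_iff.1 h.isEigenvalueMatrix
  -- With D the diagonal matrix of column j of B, the eigenvalue relation says A(DA) = (DA)D, so A
  -- is similar to D.
  have h2 : A * U = U * Matrix.diagonal fun k => B k j := by
    rw [hU]
    ext k i
    rw [Matrix.mul_diagonal, Matrix.mul_apply]
    simp only [Matrix.diagonal_mul]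
    have := h1 i j k
    rw [show B k j * A k i * B i j = B i j * (A k i * B k j) by ring, ← this]
    exact Finset.sum_congr rfl fun _ _ => by ring
  have h3 : A = U * (Matrix.diagonal fun k => B k j) * (U⁻¹ : (Matrix V V ℂ)ˣ).val := by
    rw [← h2, Units.mul_inv_cancel_right]
  rw [h3, Matrix.trace_units_conj, Matrix.trace_diagonal]

/-- For fixed i, the row vector x_l = A⁻¹_il A_li satisfies xB = A_ii 1ᵀ, while 1ᵀB = tr(A) 1ᵀ. As B
is invertible, tr(A) x = A_ii 1ᵀ; since the x_l sum to 1 and A_ii ≠ 0, each x_l is 1/n. -/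
lemma IsInvertibleJonesPair.isTypeII_left (h : IsInvertibleJonesPair A B) : IsTypeII A := by
  obtain ⟨⟨h1, h2⟩, hA0, hB⟩ := h
  have hA := (Matrix.isUnit_iff_isUnit_det A).1 h1.isUnit_left
  have key : ∀ i l, (Fintype.card V : ℂ) * (A⁻¹ i l * A l i) = 1 := by
    intro i l
    have e1 : ∀ m, ∑ l, A⁻¹ i l * A l i * B l m = A i i := by
      intro m
      have e := h1.isEigenvalueMatrix i m
      have e' := congrFun (congrArg (A⁻¹ *ᵥ ·) e) i
      simp only [Matrix.mulVec_mulVec, Matrix.nonsing_inv_mul _ hA, Matrix.one_mulVec,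
        Matrix.mulVec_smul] at e'
      simp only [eigVec, Pi.smul_apply, smul_eq_mul, Matrix.mulVec, dotProduct] at e'
      have hb := h1.right_ne_zero i m
      refine mul_left_cancel₀ hb ?_
      rw [mul_comm _ (A i i), e']
      simp_rw [mul_assoc]
    have e2 : A.trace • (fun l => A⁻¹ i l * A l i) = fun _ => A i i := by
      have hinj := Matrix.vecMul_injective_of_isUnit hB
      apply hinj
      ext m
      have c := h1.col_sum m
      have e := e1 m
      simp only [Matrix.vecMul, dotProduct, Pi.smul_apply, smul_eq_mul]
      rw [← Finset.mul_sum, c, mul_comm (A i i), ← e, Finset.mul_sum]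
      exact Finset.sum_congr rfl fun _ _ => by rw [mul_assoc A.trace]
    have e3 : ∀ l, A.trace * (A⁻¹ i l * A l i) = A i i := fun l => congrFun e2 l
    have e4 : A.trace = Fintype.card V * A i i := by
      have : ∑ l, A⁻¹ i l * A l i = 1 := by
        rw [← Matrix.mul_apply, Matrix.nonsing_inv_mul _ hA, Matrix.one_apply_eq]
      rw [← mul_one A.trace, ← this, Finset.mul_sum, Finset.sum_congr rfl fun l _ => e3 l]
      simp
    have := e3 l
    rw [e4] at this
    refine mul_left_cancel₀ (hA0 i i) ?_
    linear_combination this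
  refine ⟨hA0, ?_⟩
  have : (schurInv A)ᵀ = (Fintype.card V : ℂ) • A⁻¹ := by
    ext i l
    simp only [Matrix.transpose_apply, schurInv_apply, Matrix.smul_apply, smul_eq_mul]
    rw [← mul_left_inj' (hA0 l i), inv_mul_cancel₀ (hA0 l i), mul_assoc, key]
  rw [this, Matrix.mul_smul, Matrix.mul_nonsing_inv _ hA]

/-- The dual relation reads Bᵀ(a_j/a_i) = n A_ji (b_i/b_j). Summing coordinates, the left side
vanishes for i ≠ j: the rows of B have constant sum, by the pair (A, Bᵀ), and A is type II. -/
lemma IsInvertibleJonesPair.isTypeII_right (h : IsInvertibleJonesPair A B) : IsTypeII B := by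
  have hA := h.isTypeII_left
  obtain ⟨⟨h1, h2⟩, hA0, hB⟩ := h
  refine isTypeII_iff.2 ⟨h1.right_ne_zero, fun i j => ?_⟩
  split_ifs with hij
  · subst hij
    simp [mul_inv_cancel₀ (h1.right_ne_zero _ _)]
  · have e := (isEigenvalueMatrix_iff_dual h1.right_ne_zero hA).1 h1.isEigenvalueMatrix.swap i j
    have e' := Finset.sum_congr rfl fun k (_ : k ∈ Finset.univ) => e k
    rw [← Finset.mul_sum, Finset.sum_comm] at e'
    simp_rw [← Finset.sum_mul] at e'
    have hr : ∀ m, ∑ k, Bᵀ k m = A.trace := h2.col_sum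
    simp_rw [hr] at e'
    rw [← Finset.mul_sum, hA.row_sum, if_neg (Ne.symm hij), mul_zero] at e'
    exact (mul_eq_zero.1 e'.symm).resolve_left (mul_ne_zero (card_ne_zero_of_mem i) (hA0 j i))

lemma IsInvertibleJonesPair.isEigenvalueMatrix (h : IsInvertibleJonesPair A B) :
    IsEigenvalueMatrix A B A B :=
  h.1.1.isEigenvalueMatrix

lemma IsInvertibleJonesPair.mem_nomura₂_iff (h : IsInvertibleJonesPair A B)
    {R : Matrix V V ℂ} : R ∈ nomura₂ A B ↔ R ⊙ Aᵀ ∈ nomura A :=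
  mem_nomura₂_iff_hadamard_mem_nomura h.isTypeII_left h.isTypeII_right h.2.1 h.2.2
    h.isEigenvalueMatrix

lemma nomura₂_comm (A B : Matrix V V ℂ) : nomura₂ A B = nomura₂ B A := by
  ext R
  exact ⟨fun ⟨S, hS⟩ => ⟨Sᵀ, hS.swap⟩, fun ⟨S, hS⟩ => ⟨Sᵀ, hS.swap⟩⟩

/-- The same Schur factor Aᵀ relates N_{A,B} to N_A and N_{B,A} to N_B, and N_{A,B} = N_{B,A}. -/
lemma IsInvertibleJonesPair.nomura_eq (h : IsInvertibleJonesPair A B) : nomura A = nomura B := by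
  ext R
  have hB : IsUnit Bᵀ := by rw [Matrix.isUnit_transpose]; exact h.2.2
  have e1 := h.mem_nomura₂_iff (R := R ⊙ schurInv Aᵀ)
  have e2 := mem_nomura₂_iff_hadamard_mem_nomura (R := R ⊙ schurInv Aᵀ) h.isTypeII_right
    h.isTypeII_left h.2.1 hB h.isEigenvalueMatrix.swap
  have e3 : R ⊙ schurInv Aᵀ ⊙ Aᵀ = R := by
    ext i j; simp [h.2.1 j i]
  rw [e3] at e1 e2
  rw [← e1, ← e2, nomura₂_comm]

/-- Schur multiplication by `Aᵀ` maps `N_{A,B}` onto `N_A`. -/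
noncomputable def IsInvertibleJonesPair.nomura₂EquivNomura (h : IsInvertibleJonesPair A B) :
    nomura₂ A B ≃ₗ[ℂ] nomura A where
  toFun R := ⟨R.1 ⊙ Aᵀ, h.mem_nomura₂_iff.1 R.2⟩
  invFun R := ⟨R.1 ⊙ schurInv Aᵀ, h.mem_nomura₂_iff.2 (by
    have : R.1 ⊙ schurInv Aᵀ ⊙ Aᵀ = R.1 := by ext i j; simp [h.2.1 j i]
    rw [this]; exact R.2)⟩
  map_add' R R' := Subtype.ext (Matrix.add_hadamard _ _ _)
  map_smul' c R := Subtype.ext (Matrix.smul_hadamard _ _ _)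
  left_inv R := by
    apply Subtype.ext; ext i j; simp [h.2.1 j i]
  right_inv R := by
    apply Subtype.ext; ext i j; simp [h.2.1 j i]

/-- The map `R ↦ D Rᵀ D⁻¹`, where `D` is the diagonal matrix with diagonal `d`. -/
noncomputable def twist (d : V → ℂ) (R : Matrix V V ℂ) : Matrix V V ℂ :=
  Matrix.of fun i j => d i * R j i * (d j)⁻¹

lemma twist_apply (d : V → ℂ) (R : Matrix V V ℂ) (i j : V) :
    twist d R i j = d i * R j i * (d j)⁻¹ := rfl

@[simp]
lemma twist_zero (d : V → ℂ) : twist d (0 : Matrix V V ℂ) = 0 := by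
  ext; simp [twist_apply]

lemma twist_one {d : V → ℂ} (hd : ∀ i, d i ≠ 0) : twist d (1 : Matrix V V ℂ) = 1 := by
  ext i j
  by_cases h : i = j
  · subst h; simp [twist_apply, hd]
  · simp [twist_apply, h, Ne.symm h]

lemma twist_mul {d : V → ℂ} (hd : ∀ i, d i ≠ 0) (R R' : Matrix V V ℂ) :
    twist d R * twist d R' = twist d (R' * R) := by
  ext i j
  simp only [Matrix.mul_apply, twist_apply, Finset.mul_sum, Finset.sum_mul]
  refine Finset.sum_congr rfl fun k _ => ?_
  have := hd k
  field_simp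

lemma twist_sum {κ : Type*} (d : V → ℂ) (s : Finset κ) (E : κ → Matrix V V ℂ) :
    twist d (∑ q ∈ s, E q) = ∑ q ∈ s, twist d (E q) := by
  ext i j
  simp [twist_apply, Matrix.sum_apply, Finset.mul_sum, Finset.sum_mul]

lemma twist_smul (d : V → ℂ) (a : ℂ) (R : Matrix V V ℂ) : twist d (a • R) = a • twist d R := by
  ext i j
  simp [twist_apply]; ring

lemma diagonal_mul_transpose_mul_inv {d : V → ℂ} (hd : ∀ i, d i ≠ 0) (R : Matrix V V ℂ) :
    Matrix.diagonal d * Rᵀ * (Matrix.diagonal d)⁻¹ = twist d R := by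
  have h : (Matrix.diagonal d)⁻¹ = Matrix.diagonal fun i => (d i)⁻¹ := by
    apply Matrix.inv_eq_right_inv
    rw [Matrix.diagonal_mul_diagonal, ← Matrix.diagonal_one]
    congr 1; ext i; exact mul_inv_cancel₀ (hd i)
  rw [h]
  ext i j
  simp [twist_apply]

/-- The condition on c says that the Schur product of the twist of R with Aᵀ is the transpose of R ∘
Aᵀ, and N_A is closed under transposition. -/
lemma IsInvertibleJonesPair.twist_mem (h : IsInvertibleJonesPair A B) {c : V → ℂ}
    (hc : ∀ i, c i ≠ 0) (hAC : ∀ i j, A j i * c i ^ 2 = A i j * c j ^ 2) {R : Matrix V V ℂ}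
    (hR : R ∈ nomura₂ A B) :
    twist (c ^ 2) R ∈ nomura₂ A B := by
  rw [h.mem_nomura₂_iff] at hR ⊢
  convert transpose_mem_nomura h.isTypeII_left hR using 1
  ext i j
  have := hAC i j
  have hj := hc j
  simp only [Matrix.hadamard_apply, twist_apply, Pi.pow_apply, Matrix.transpose_apply]
  field_simp
  linear_combination R j i * this

end JonesPair

-- Existence of bases of principal idempotents

section Idempotents

universe u

lemma linearIndependent_of_projections {κ M : Type*} [AddCommGroup M] [Module ℂ M]
    {E : κ → M} (φ : κ → M →ₗ[ℂ] M) (h0 : ∀ i, E i ≠ 0) (h1 : ∀ i, φ i (E i) = E i)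
    (h2 : ∀ i j, i ≠ j → φ i (E j) = 0) : LinearIndependent ℂ E := by
  classical
  rw [linearIndependent_iff']
  intro s g hg i hi
  have h := congrArg (φ i) hg
  rw [map_sum, map_zero, Finset.sum_eq_single i] at h
  · rw [map_smul, h1] at h
    exact (smul_eq_zero.1 h).resolve_right (h0 i)
  · intro j _ hji
    rw [map_smul, h2 i j (Ne.symm hji), smul_zero]
  · exact fun h' => absurd hi h'

/-- An algebra of functions on a finite set contains the indicator functions of the classes of
points that it does not separate. -/
lemma exists_indicator_mem {X : Type*} [Fintype X] (D : Subalgebra ℂ (X → ℂ)) (x : X) :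
    ∃ e ∈ D, ∀ y, ((∀ f ∈ D, f y = f x) → e y = 1) ∧ (¬ (∀ f ∈ D, f y = f x) → e y = 0) := by
  classical
  -- Interpolation: for each y a function that is 1 at x and vanishes at y if D separates them; the
  -- product over y is the indicator.
  have h : ∀ y, ∃ e ∈ D, e x = 1 ∧ (¬ (∀ f ∈ D, f y = f x) → e y = 0) := by
    intro y
    by_cases hy : ∀ f ∈ D, f y = f x
    · exact ⟨1, D.one_mem, rfl, fun h => absurd hy h⟩
    · push Not at hy
      obtain ⟨f, hf, hfy⟩ := hy
      refine ⟨(f x - f y)⁻¹ • (f - algebraMap ℂ (X → ℂ) (f y)),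
        D.smul_mem (D.sub_mem hf (D.algebraMap_mem _)) _, ?_, fun _ => ?_⟩
      · simp [inv_mul_cancel₀ (sub_ne_zero.2 (Ne.symm hfy))]
      · simp
  choose e he hex hey using h
  refine ⟨∏ y, e y, D.prod_mem fun y _ => he y, fun y => ⟨fun hy => ?_, fun hy => ?_⟩⟩
  · rw [hy _ (D.prod_mem fun y _ => he y), Finset.prod_apply]
    exact Finset.prod_eq_one fun z _ => hex z
  · rw [Finset.prod_apply]
    exact Finset.prod_eq_zero (Finset.mem_univ y) (hey y hy)

lemma exists_indicator_basis {X : Type u} [Fintype X] (D : Subalgebra ℂ (X → ℂ)) :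
    ∃ (Q : Type u) (_ : Fintype Q) (e : Q → X → ℂ), (∀ q, e q ∈ D) ∧ (∀ q, e q ≠ 0) ∧
      (∀ q, e q * e q = e q) ∧ (∀ p q, p ≠ q → e p * e q = 0) ∧ ∑ q, e q = 1 ∧
      ∀ f ∈ D, ∃ a : Q → ℂ, f = ∑ q, a q • e q := by
  classical
  let s : Setoid X := ⟨fun x y => ∀ f ∈ D, f x = f y, fun _ _ _ => rfl,
    fun h f hf => (h f hf).symm, fun h h' f hf => (h f hf).trans (h' f hf)⟩
  choose e he hee using exists_indicator_mem D
  have key : ∀ (q : Quotient s) (y : X), e q.out y = if q = ⟦y⟧ then 1 else 0 := by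
    intro q y
    have h : q = ⟦y⟧ ↔ ∀ f ∈ D, f y = f q.out := by
      conv_lhs => rw [← q.out_eq, Quotient.eq]
      exact ⟨fun h f hf => (h f hf).symm, fun h f hf => (h f hf).symm⟩
    split_ifs with hq
    · exact (hee q.out y).1 (h.1 hq)
    · exact (hee q.out y).2 fun h' => hq (h.2 h')
  refine ⟨Quotient s, inferInstance, fun q => e q.out, fun q => he _, fun q h => ?_, fun q => ?_,
    fun p q hpq => ?_, ?_, fun f hf => ⟨fun q : Quotient s => f q.out, ?_⟩⟩
  · have := congrFun h q.out
    simp [key] at this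
  · ext y; simp [key]
  · ext y
    simp only [Pi.mul_apply, key, Pi.zero_apply, mul_ite, mul_one, mul_zero]
    split_ifs with h1 h2
    · exact absurd (h2.trans h1.symm) hpq
    · rfl
    · rfl
  · ext y; simp [key]
  · ext y
    simp only [Finset.sum_apply, Pi.smul_apply, key, smul_eq_mul, mul_ite, mul_one, mul_zero,
      Finset.sum_ite_eq', Finset.mem_univ, if_true]
    exact (Quotient.mk_out (s := s) y f hf).symm

variable {V : Type*} [Fintype V] [DecidableEq V] {A B : Matrix V V ℂ}

lemma IsPrincipalIdempotentBasis.finrank_eq {κ : Type*} [Fintype κ]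
    {N : Subalgebra ℂ (Matrix V V ℂ)} {E : κ → Matrix V V ℂ}
    (h : IsPrincipalIdempotentBasis N E) : Module.finrank ℂ N = Fintype.card κ := by
  have h1 := finrank_span_eq_card h.1
  rwa [h.2.1] at h1

lemma IsSchurIdempotentBasis.finrank_eq {κ : Type*} [Fintype κ]
    {N : Subalgebra ℂ (Matrix V V ℂ)} {E : κ → Matrix V V ℂ}
    (h : IsSchurIdempotentBasis N E) : Module.finrank ℂ N = Fintype.card κ := by
  have h1 := finrank_span_eq_card h.1
  rwa [h.2.1] at h1

/-- Nonzero orthogonal idempotents with sum `1` that span `N` form its basis of principal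
idempotents. -/
lemma IsPrincipalIdempotentBasis.of_span {κ : Type*} [Fintype κ]
    {N : Subalgebra ℂ (Matrix V V ℂ)} {E : κ → Matrix V V ℂ} (h0 : ∀ i, E i ≠ 0)
    (hspan : Submodule.span ℂ (Set.range E) = Subalgebra.toSubmodule N)
    (h1 : ∀ i, E i * E i = E i) (h2 : ∀ i j, i ≠ j → E i * E j = 0) (h3 : ∑ i, E i = 1) :
    IsPrincipalIdempotentBasis N E :=
  ⟨linearIndependent_of_projections (fun i => opX (E i)) h0 h1 h2, hspan, h1, h2, h3⟩

lemma IsSchurIdempotentBasis.of_span {κ : Type*} [Fintype κ]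
    {N : Subalgebra ℂ (Matrix V V ℂ)} {E : κ → Matrix V V ℂ} (h0 : ∀ i, E i ≠ 0)
    (hspan : Submodule.span ℂ (Set.range E) = Subalgebra.toSubmodule N)
    (h1 : ∀ i, E i ⊙ E i = E i) (h2 : ∀ i j, i ≠ j → E i ⊙ E j = 0)
    (h3 : ∑ i, E i = Matrix.of fun _ _ => 1) :
    IsSchurIdempotentBasis N E :=
  ⟨linearIndependent_of_projections (fun i => opD (E i)) h0 h1 h2, hspan, h1, h2, h3⟩

/-- Θ_{A,B} is injective and turns products into entrywise ones, so N_{A,B} is isomorphic to an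
algebra D of functions on V × V; the indicator basis of D is pulled back. -/
theorem exists_isPrincipalIdempotentBasis_nomura₂ (hA : ∀ i j, A i j ≠ 0) (hB : IsTypeII B) :
    ∃ E : Fin (Module.finrank ℂ (nomura₂ A B)) → Matrix V V ℂ,
      IsPrincipalIdempotentBasis (nomura₂ A B) E := by
  let D : Subalgebra ℂ (V × V → ℂ) :=
    { carrier := {f | ∃ R, IsEigenvalueMatrix A B R (Matrix.of fun i j => f (i, j))}
      mul_mem' := fun ⟨R, hR⟩ ⟨R', hR'⟩ => ⟨R * R', hR.mul hR'⟩
      add_mem' := fun ⟨R, hR⟩ ⟨R', hR'⟩ => ⟨R + R', hR.add hR'⟩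
      algebraMap_mem' := fun c => ⟨c • 1, by
        convert (IsEigenvalueMatrix.one (A := A) (B := B)).smul c using 1
        ext i j; simp⟩ }
  obtain ⟨Q, _, e, heD, he0, he1, he2, he3, he4⟩ := exists_indicator_basis D
  choose E hE using heD
  have hb : IsPrincipalIdempotentBasis (nomura₂ A B) E := by
    refine .of_span (fun q h => ?_) (le_antisymm ?_ ?_) (fun q => ?_) (fun p q hpq => ?_) ?_
    · have h1 := hE q
      rw [h] at h1
      have h2 := h1.unique hA hB.1 IsEigenvalueMatrix.zero
      exact he0 q (funext fun x => congrFun (congrFun h2 x.1) x.2)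
    · rw [Submodule.span_le]
      rintro _ ⟨q, rfl⟩
      exact ⟨_, hE q⟩
    · rintro R ⟨S, hS⟩
      obtain ⟨a, ha⟩ := he4 (fun x => S x.1 x.2) ⟨R, hS⟩
      have h1 := IsEigenvalueMatrix.sum (s := Finset.univ) fun q _ => (hE q).smul (a q)
      have h2 : R = ∑ q, a q • E q := by
        refine hS.unique_left hA hB ?_
        convert h1 using 1
        ext i j
        simpa [Matrix.sum_apply] using congrFun ha (i, j)
      rw [h2]
      exact Submodule.sum_mem _ fun q _ =>
        Submodule.smul_mem _ _ (Submodule.subset_span ⟨q, rfl⟩)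
    · refine ((hE q).mul (hE q)).unique_left hA hB ?_
      convert hE q using 1
      ext i j
      exact congrFun (he1 q) (i, j)
    · refine ((hE p).mul (hE q)).unique_left hA hB ?_
      convert IsEigenvalueMatrix.zero (A := A) (B := B) using 1
      ext i j
      exact congrFun (he2 p q hpq) (i, j)
    · refine (IsEigenvalueMatrix.sum fun q _ => hE q).unique_left hA hB ?_
      convert IsEigenvalueMatrix.one (A := A) (B := B) using 1
      ext i j
      simpa [Matrix.sum_apply] using congrFun he3 (i, j)
  let f := Fintype.equivFinOfCardEq hb.finrank_eq.symm
  obtain ⟨g1, g2, g3, g4, g5⟩ := hb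
  refine ⟨E ∘ f.symm, g1.comp _ f.symm.injective, ?_, fun i => g3 _,
    fun i j hij => g4 _ _ (f.symm.injective.ne hij), ?_⟩
  · rw [f.symm.surjective.range_comp, g2]
  · rw [← g5]
    exact f.symm.sum_comp E

end Idempotents

-- The algebra of W in block form

section BlockMatrix

variable {V : Type*} [Fintype V] [DecidableEq V] {A B : Matrix V V ℂ} {c : V → ℂ}

lemma matrixW_inl (k : V) (a : V ⊕ V) : matrixW A B (Matrix.diagonal c) (Sum.inl k) a
    = Sum.elim (1 : V → ℂ) (-1) a * A (Sum.elim id id a) k := by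
  rcases a with i | i <;> simp [matrixW]

lemma matrixW_inr (k : V) (a : V ⊕ V) : matrixW A B (Matrix.diagonal c) (Sum.inr k) a
    = (B (Sum.elim id id a) k)⁻¹ * c (Sum.elim id id a) := by
  rcases a with i | i <;> simp [matrixW]

lemma matrixW_ne_zero (hA : ∀ i j, A i j ≠ 0) (hB : ∀ i j, B i j ≠ 0) (hc : ∀ i, c i ≠ 0)
    (a b : V ⊕ V) : matrixW A B (Matrix.diagonal c) a b ≠ 0 := by
  rcases a with k | k
  · rw [matrixW_inl]
    refine mul_ne_zero ?_ (hA _ _)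
    rcases b with i | i <;> simp
  · rw [matrixW_inr]
    exact mul_ne_zero (inv_ne_zero (hB _ _)) (hc _)

lemma isTypeII_matrixW (hA : IsTypeII A) (hB : IsTypeII B) (hc : ∀ i, c i ≠ 0) :
    IsTypeII (matrixW A B (Matrix.diagonal c)) := by
  refine isTypeII_iff.2 ⟨matrixW_ne_zero hA.1 hB.1 hc, fun a b => ?_⟩
  have h1 := hA.col_sum
  have h2 : ∀ i j, ∑ m, (B m i)⁻¹ * c m * (B m j * (c m)⁻¹)
      = if i = j then (Fintype.card V : ℂ) else 0 := by
    intro i j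
    simp only [eq_comm (a := i)]
    rw [← hB.col_sum j i]
    refine Finset.sum_congr rfl fun m _ => ?_
    have := hc m
    field_simp
  rcases a with k | k <;> rcases b with l | l <;>
    simp only [Fintype.sum_sum_type, matrixW_inl, matrixW_inr, Sum.elim_inl, Sum.elim_inr,
      Pi.one_apply, Pi.neg_apply, one_mul, neg_mul, inv_neg, inv_one, mul_neg, neg_neg, h1, h2, id,
      mul_inv, inv_inv, Fintype.card_sum, Nat.cast_add, Sum.inl.injEq, Sum.inr.injEq,
      Finset.sum_neg_distrib, reduceCtorEq, if_false, add_neg_cancel]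
  all_goals split_ifs <;> simp

/-- The eigenvalue relation for `W` in terms of the quotients of the rows of `A` and of `B`. -/
lemma isEigenvalueMatrix_matrixW_iff {P Q U T : Matrix V V ℂ}
    {S : Matrix (V ⊕ V) (V ⊕ V) ℂ} :
    IsEigenvalueMatrix (matrixW A B (Matrix.diagonal c))
      (schurInv (matrixW A B (Matrix.diagonal c))) (Matrix.fromBlocks P Q U T) S ↔
    -- Here i, j are kept apart from s, t so that the four choices of signs over the same i, j
    -- involve literally the same sums.
    ∀ i j k (s t : V ⊕ V), Sum.elim id id s = i → Sum.elim id id t = j →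
      Sum.elim (1 : V → ℂ) (-1) s * Sum.elim (1 : V → ℂ) (-1) t *
          ∑ m, P k m * (A i m * (A j m)⁻¹) +
        c i * (c j)⁻¹ * ∑ m, Q k m * (B j m * (B i m)⁻¹)
        = S s t * (Sum.elim (1 : V → ℂ) (-1) s * Sum.elim (1 : V → ℂ) (-1) t *
          (A i k * (A j k)⁻¹)) ∧
      Sum.elim (1 : V → ℂ) (-1) s * Sum.elim (1 : V → ℂ) (-1) t *
          ∑ m, U k m * (A i m * (A j m)⁻¹) +
        c i * (c j)⁻¹ * ∑ m, T k m * (B j m * (B i m)⁻¹)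
        = S s t * (c i * (c j)⁻¹ * (B j k * (B i k)⁻¹)) := by
  have hε : ∀ t : V ⊕ V, (Sum.elim (1 : V → ℂ) (-1) t)⁻¹ = Sum.elim (1 : V → ℂ) (-1) t := by
    rintro (t | t) <;> simp
  have e1 : ∀ (P : Matrix V V ℂ) (k : V) (s t : V ⊕ V), ∑ m, P k m *
      (matrixW A B (Matrix.diagonal c) (Sum.inl m) s *
        (matrixW A B (Matrix.diagonal c) (Sum.inl m) t)⁻¹)
      = Sum.elim (1 : V → ℂ) (-1) s * Sum.elim (1 : V → ℂ) (-1) t *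
        ∑ m, P k m * (A (Sum.elim id id s) m * (A (Sum.elim id id t) m)⁻¹) := by
    intro P k s t
    rw [Finset.mul_sum]
    refine Finset.sum_congr rfl fun m _ => ?_
    rw [matrixW_inl, matrixW_inl, mul_inv, hε]
    ring
  have e2 : ∀ (Q : Matrix V V ℂ) (k : V) (s t : V ⊕ V), ∑ m, Q k m *
      (matrixW A B (Matrix.diagonal c) (Sum.inr m) s *
        (matrixW A B (Matrix.diagonal c) (Sum.inr m) t)⁻¹)
      = c (Sum.elim id id s) * (c (Sum.elim id id t))⁻¹ *
        ∑ m, Q k m * (B (Sum.elim id id t) m * (B (Sum.elim id id s) m)⁻¹) := by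
    intro Q k s t
    rw [Finset.mul_sum]
    refine Finset.sum_congr rfl fun m _ => ?_
    rw [matrixW_inr, matrixW_inr, mul_inv, inv_inv]
    ring
  have e3 : ∀ (k : V) (s t : V ⊕ V), matrixW A B (Matrix.diagonal c) (Sum.inl k) s *
        (matrixW A B (Matrix.diagonal c) (Sum.inl k) t)⁻¹
      = Sum.elim (1 : V → ℂ) (-1) s * Sum.elim (1 : V → ℂ) (-1) t *
        (A (Sum.elim id id s) k * (A (Sum.elim id id t) k)⁻¹) := by
    intro k s t
    rw [matrixW_inl, matrixW_inl, mul_inv, hε]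
    ring
  have e4 : ∀ (k : V) (s t : V ⊕ V), matrixW A B (Matrix.diagonal c) (Sum.inr k) s *
        (matrixW A B (Matrix.diagonal c) (Sum.inr k) t)⁻¹
      = c (Sum.elim id id s) * (c (Sum.elim id id t))⁻¹ *
        (B (Sum.elim id id t) k * (B (Sum.elim id id s) k)⁻¹) := by
    intro k s t
    rw [matrixW_inr, matrixW_inr, mul_inv, inv_inv]
    ring
  rw [isEigenvalueMatrix_iff]
  constructor
  · rintro h i j k s t rfl rfl
    have h1 := h s t (Sum.inl k)
    have h2 := h s t (Sum.inr k)
    simp only [schurInv_apply, Fintype.sum_sum_type, Matrix.fromBlocks_apply₁₁,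
      Matrix.fromBlocks_apply₁₂, Matrix.fromBlocks_apply₂₁, Matrix.fromBlocks_apply₂₂,
      e1, e2] at h1 h2
    rw [e3] at h1
    rw [e4] at h2
    exact ⟨h1, h2⟩
  · intro h s t k
    rcases k with k | k
    · have h1 := (h _ _ k s t rfl rfl).1
      simp only [schurInv_apply, Fintype.sum_sum_type, Matrix.fromBlocks_apply₁₁,
        Matrix.fromBlocks_apply₁₂, e1, e2]
      rw [e3]
      exact h1
    · have h1 := (h _ _ k s t rfl rfl).2
      simp only [schurInv_apply, Fintype.sum_sum_type, Matrix.fromBlocks_apply₂₁,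
        Matrix.fromBlocks_apply₂₂, e1, e2]
      rw [e4]
      exact h1

/-- The element of `N_W` attached to `E ∈ N_A` and `F ∈ N_{A,B}`. -/
noncomputable def thetaBlocks (A B : Matrix V V ℂ) (c : V → ℂ) (E F : Matrix V V ℂ) :
    Matrix (V ⊕ V) (V ⊕ V) ℂ :=
  Matrix.fromBlocks (Theta A E) (Theta₂ A B F)
    (Theta₂ A B (twist (c ^ 2) F))ᵀ (Theta B E)ᵀ

/-- The element of `N_{Wᵀ}` attached to `E ∈ N_A` and `F ∈ N_{A,B}`. -/
noncomputable def dualBlocks (c : V → ℂ) (E F : Matrix V V ℂ) : Matrix (V ⊕ V) (V ⊕ V) ℂ :=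
  Matrix.fromBlocks (Eᵀ + twist c F) (Eᵀ - twist c F) (Eᵀ - twist c F) (Eᵀ + twist c F)

/-- Both diagonal blocks have eigenvalue n E_ji on their quotient vectors. The twist by c² in the
lower left block makes both off-diagonal blocks contribute n (c_i/c_j) F_ji, up to the common sign.
-/
lemma isEigenvalueMatrix_thetaBlocks (h : IsInvertibleJonesPair A B) (hc : ∀ i, c i ≠ 0)
    (hAC : ∀ i j, A j i * c i ^ 2 = A i j * c j ^ 2) {E F : Matrix V V ℂ}
    (hE : E ∈ nomura A) (hF : F ∈ nomura₂ A B) :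
    IsEigenvalueMatrix (matrixW A B (Matrix.diagonal c))
      (schurInv (matrixW A B (Matrix.diagonal c))) (thetaBlocks A B c E F)
      ((Fintype.card V : ℂ) • dualBlocks c E F) := by
  have hA := h.isTypeII_left
  have hB := h.isTypeII_right
  have h1 := Theta₂_spec hE
  have h2 := (Theta₂_spec (h.nomura_eq ▸ hE : E ∈ nomura B)).nomura_transpose hB
  have h3 := Theta₂_spec hF
  have h4 := (Theta₂_spec (h.twist_mem hc hAC hF)).swap
  rw [isEigenvalueMatrix_iff_dual hA.1 hA.schurInv] at h1
  rw [isEigenvalueMatrix_iff_dual hB.1 hB.schurInv] at h2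
  rw [isEigenvalueMatrix_iff_dual hA.1 hB] at h3
  rw [isEigenvalueMatrix_iff_dual hB.1 hA] at h4
  simp only [schurInv_apply, inv_inv, mul_comm (A _ _)⁻¹, mul_comm (B _ _)⁻¹] at h1 h2
  rw [thetaBlocks, isEigenvalueMatrix_matrixW_iff]
  intro i j k s t hs ht
  have g1 := h1 i j k
  have g2 := h2 j i k
  have g3 := h3 i j k
  have g4 := h4 j i k
  have ci := hc i
  have cj := hc j
  rw [Theta, Theta, g1, g2, g3, g4]
  rcases s with s | s <;> rcases t with t | t <;>
  · simp only [Sum.elim_inl, Sum.elim_inr, id] at hs ht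
    subst hs ht
    simp only [dualBlocks, Matrix.smul_apply, Matrix.fromBlocks_apply₁₁,
      Matrix.fromBlocks_apply₁₂, Matrix.fromBlocks_apply₂₁, Matrix.fromBlocks_apply₂₂,
      Matrix.add_apply, Matrix.sub_apply, Matrix.transpose_apply, smul_eq_mul,
      twist_apply, Pi.pow_apply,
      Sum.elim_inl, Sum.elim_inr, Pi.one_apply, Pi.neg_apply]
    constructor <;> field_simp <;> ring

lemma exists_of_isEigenvalueMatrix_matrixW (h : IsInvertibleJonesPair A B) (hc : ∀ i, c i ≠ 0)
    (hAC : ∀ i j, A j i * c i ^ 2 = A i j * c j ^ 2) {M S : Matrix (V ⊕ V) (V ⊕ V) ℂ}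
    (hM : IsEigenvalueMatrix (matrixW A B (Matrix.diagonal c))
      (schurInv (matrixW A B (Matrix.diagonal c))) M S) :
    ∃ E ∈ nomura A, ∃ F ∈ nomura₂ A B, M = thetaBlocks A B c E F ∧
      S = (Fintype.card V : ℂ) • dualBlocks c E F := by
  have hA := h.isTypeII_left
  have hB := h.isTypeII_right
  have hW := isTypeII_matrixW hA hB hc
  obtain ⟨P, Q, U, T, rfl⟩ : ∃ P Q U T, M = Matrix.fromBlocks P Q U T :=
    ⟨_, _, _, _, (Matrix.fromBlocks_toBlocks M).symm⟩
  have hM' := isEigenvalueMatrix_matrixW_iff.1 hM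
  -- Half the sum of the eigenvalues for equal and opposite signs is n E_ji; half the difference is
  -- n (c_i/c_j) F_ji, whence the factor c_j/c_i in `hQ`.
  have hP : IsEigenvalueMatrix A (schurInv A) (Matrix.of fun j i =>
      (S (Sum.inl i) (Sum.inl j) + S (Sum.inl i) (Sum.inr j)) / (2 * Fintype.card V)) P := by
    rw [isEigenvalueMatrix_iff_dual hA.1 hA.schurInv]
    intro i j k
    have h1 := (hM' i j k (.inl i) (.inl j) rfl rfl).1
    have h2 := (hM' i j k (.inl i) (.inr j) rfl rfl).1
    have hn := card_ne_zero_of_mem i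
    simp only [Sum.elim_inl, Sum.elim_inr, Pi.one_apply, Pi.neg_apply] at h1 h2
    simp only [schurInv_apply, inv_inv, mul_comm (A _ _)⁻¹, Matrix.of_apply]
    generalize ∑ m, P k m * (A i m * (A j m)⁻¹) = p at h1 h2 ⊢
    rw [show (Fintype.card V : ℂ) * ((S (Sum.inl i) (Sum.inl j) + S (Sum.inl i) (Sum.inr j)) /
        (2 * Fintype.card V)) = (S (Sum.inl i) (Sum.inl j) + S (Sum.inl i) (Sum.inr j)) / 2 by
      field_simp]
    linear_combination (h1 - h2) / 2
  have hQ : IsEigenvalueMatrix A B (Matrix.of fun j i => c j * (c i)⁻¹ *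
      (S (Sum.inl i) (Sum.inl j) - S (Sum.inl i) (Sum.inr j)) / (2 * Fintype.card V)) Q := by
    rw [isEigenvalueMatrix_iff_dual hA.1 hB]
    intro i j k
    have h1 := (hM' i j k (.inl i) (.inl j) rfl rfl).1
    have h2 := (hM' i j k (.inl i) (.inr j) rfl rfl).1
    have hn := card_ne_zero_of_mem i
    have ci := hc i
    have cj := hc j
    simp only [Sum.elim_inl, Sum.elim_inr, Pi.one_apply, Pi.neg_apply] at h1 h2
    have h3 : 2 * (c i * (c j)⁻¹) * ∑ m, Q k m * (B j m * (B i m)⁻¹) =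
        (S (Sum.inl i) (Sum.inl j) - S (Sum.inl i) (Sum.inr j)) * (A i k * (A j k)⁻¹) := by
      linear_combination h1 + h2
    rw [← mul_right_inj' (show (2 * (c i * (c j)⁻¹)) ≠ 0 by simp [ci, cj]), h3]
    simp only [Matrix.of_apply]
    field_simp
  -- Only the product of the two signs enters the equations.
  have hS : ∀ i j, S (Sum.inr i) (Sum.inr j) = S (Sum.inl i) (Sum.inl j) ∧
      S (Sum.inr i) (Sum.inl j) = S (Sum.inl i) (Sum.inr j) := by
    intro i j
    have h0 : A i i * (A j i)⁻¹ ≠ 0 := mul_ne_zero (hA.1 i i) (inv_ne_zero (hA.1 j i))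
    have h1 := (hM' i j i (.inl i) (.inl j) rfl rfl).1
    have h2 := (hM' i j i (.inr i) (.inr j) rfl rfl).1
    have h3 := (hM' i j i (.inl i) (.inr j) rfl rfl).1
    have h4 := (hM' i j i (.inr i) (.inl j) rfl rfl).1
    simp only [Sum.elim_inl, Sum.elim_inr, Pi.one_apply, Pi.neg_apply] at h1 h2 h3 h4
    exact ⟨mul_right_cancel₀ h0 (by linear_combination h1 - h2),
      mul_right_cancel₀ h0 (by linear_combination h4 - h3)⟩
  have hSd : S = (Fintype.card V : ℂ) • dualBlocks c
      (Matrix.of fun j i =>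
        (S (Sum.inl i) (Sum.inl j) + S (Sum.inl i) (Sum.inr j)) / (2 * Fintype.card V))
      (Matrix.of fun j i => c j * (c i)⁻¹ *
        (S (Sum.inl i) (Sum.inl j) - S (Sum.inl i) (Sum.inr j)) / (2 * Fintype.card V)) := by
    ext s t
    rcases s with i | i <;> rcases t with j | j <;>
    · have hn := card_ne_zero_of_mem i
      have ci := hc i
      have cj := hc j
      simp only [dualBlocks, Matrix.smul_apply, Matrix.fromBlocks_apply₁₁,
        Matrix.fromBlocks_apply₁₂, Matrix.fromBlocks_apply₂₁, Matrix.fromBlocks_apply₂₂,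
        Matrix.add_apply, Matrix.sub_apply, Matrix.transpose_apply, Matrix.of_apply, smul_eq_mul,
        twist_apply,
        hS i j]
      field_simp
      ring
  refine ⟨_, ⟨P, hP⟩, _, ⟨Q, hQ⟩, ?_, hSd⟩
  -- The lower blocks are never solved for: two elements of N_W with the same eigenvalues coincide.
  have hM2 := isEigenvalueMatrix_thetaBlocks h hc hAC ⟨P, hP⟩ ⟨Q, hQ⟩
  rw [← hSd] at hM2
  exact hM.unique_left hW.1 hW.schurInv hM2

end BlockMatrix

-- Idempotent bases of N_W and N_{Wᵀ}

section BlockBases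

variable {V : Type*} [Fintype V] [DecidableEq V] {A B : Matrix V V ℂ} {c : V → ℂ}

lemma Theta₂_zero (hA : ∀ i j, A i j ≠ 0) (hB : ∀ i j, B i j ≠ 0) : Theta₂ A B 0 = 0 :=
  Theta₂_eq hA hB .zero

lemma Theta₂_one (hA : ∀ i j, A i j ≠ 0) (hB : ∀ i j, B i j ≠ 0) :
    Theta₂ A B 1 = Matrix.of fun _ _ => 1 :=
  Theta₂_eq hA hB .one

lemma Theta₂_mul (hA : ∀ i j, A i j ≠ 0) (hB : ∀ i j, B i j ≠ 0) {R R' : Matrix V V ℂ}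
    (hR : R ∈ nomura₂ A B) (hR' : R' ∈ nomura₂ A B) :
    Theta₂ A B R ⊙ Theta₂ A B R' = Theta₂ A B (R * R') :=
  (Theta₂_eq hA hB ((Theta₂_spec hR).mul (Theta₂_spec hR'))).symm

lemma IsPrincipalIdempotentBasis.mem {κ : Type*} [Fintype κ]
    {N : Subalgebra ℂ (Matrix V V ℂ)} {E : κ → Matrix V V ℂ}
    (h : IsPrincipalIdempotentBasis N E) (i : κ) : E i ∈ N := by
  rw [← Subalgebra.mem_toSubmodule, ← h.2.1]
  exact Submodule.subset_span ⟨i, rfl⟩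

lemma IsPrincipalIdempotentBasis.exists_eq_sum {κ : Type*} [Fintype κ]
    {N : Subalgebra ℂ (Matrix V V ℂ)} {E : κ → Matrix V V ℂ}
    (h : IsPrincipalIdempotentBasis N E) {R : Matrix V V ℂ} (hR : R ∈ N) :
    ∃ a : κ → ℂ, R = ∑ i, a i • E i := by
  rw [← Subalgebra.mem_toSubmodule, ← h.2.1, Submodule.mem_span_range_iff_exists_fun] at hR
  obtain ⟨a, ha⟩ := hR
  exact ⟨a, ha.symm⟩

lemma dualBlocks_sum {κ κ' : Type*} [Fintype κ] [Fintype κ'] (a : κ → ℂ) (b : κ' → ℂ)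
    (E : κ → Matrix V V ℂ) (F : κ' → Matrix V V ℂ) :
    dualBlocks c (∑ i, a i • E i) (∑ j, b j • F j)
      = ∑ i, a i • dualBlocks c (E i) 0 + ∑ j, b j • dualBlocks c 0 (F j) := by
  ext s t
  rcases s with s | s <;> rcases t with t | t <;>
    simp [dualBlocks, Matrix.sum_apply, twist_sum, twist_smul, sub_eq_add_neg]

/-- The cross terms cancel by the sign pattern. The factor 2 is the source of the 1/2 in the
principal idempotents; transposition reverses the factors. -/
lemma dualBlocks_mul (hc : ∀ i, c i ≠ 0) (E F E' F' : Matrix V V ℂ) :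
    dualBlocks c E F * dualBlocks c E' F' = (2 : ℂ) • dualBlocks c (E' * E) (F' * F) := by
  simp only [dualBlocks, Matrix.fromBlocks_multiply, Matrix.fromBlocks_smul,
    Matrix.transpose_mul, ← twist_mul hc]
  congr 1 <;> rw [two_smul] <;> noncomm_ring

lemma dualBlocks_eq_zero (hc : ∀ i, c i ≠ 0) {E F : Matrix V V ℂ} (h : dualBlocks c E F = 0) :
    E = 0 ∧ F = 0 := by
  have h1 : ∀ i j, E j i + twist c F i j = 0 := fun i j => by
    simpa [dualBlocks] using congrFun (congrFun h (.inl i)) (.inl j)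
  have h2 : ∀ i j, E j i - twist c F i j = 0 := fun i j => by
    simpa [dualBlocks] using congrFun (congrFun h (.inl i)) (.inr j)
  constructor
  · ext j i
    have h3 := h1 i j
    have h4 := h2 i j
    rw [Matrix.zero_apply]
    linear_combination (h3 + h4) / 2
  · ext j i
    have h3 := h1 i j
    have h4 := h2 i j
    have : twist c F i j = 0 := by linear_combination (h3 - h4) / 2
    simpa [twist_apply, hc] using this

lemma thetaBlocks_sum (h : IsInvertibleJonesPair A B) (hc : ∀ i, c i ≠ 0)
    (hAC : ∀ i j, A j i * c i ^ 2 = A i j * c j ^ 2) {κ κ' : Type*} [Fintype κ] [Fintype κ']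
    (a : κ → ℂ) (b : κ' → ℂ) {E : κ → Matrix V V ℂ} {F : κ' → Matrix V V ℂ}
    (hE : ∀ i, E i ∈ nomura A) (hF : ∀ j, F j ∈ nomura₂ A B) :
    thetaBlocks A B c (∑ i, a i • E i) (∑ j, b j • F j)
      = ∑ i, a i • thetaBlocks A B c (E i) 0 + ∑ j, b j • thetaBlocks A B c 0 (F j) := by
  have hW := isTypeII_matrixW h.isTypeII_left h.isTypeII_right hc
  have h1 := isEigenvalueMatrix_thetaBlocks h hc hAC
    (Subalgebra.sum_mem _ fun i (_ : i ∈ Finset.univ) => Subalgebra.smul_mem _ (hE i) (a i))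
    (Subalgebra.sum_mem _ fun i (_ : i ∈ Finset.univ) => Subalgebra.smul_mem _ (hF i) (b i))
  have h2 := IsEigenvalueMatrix.sum (s := Finset.univ) fun i _ =>
    (isEigenvalueMatrix_thetaBlocks h hc hAC (hE i) (Subalgebra.zero_mem _)).smul (a i)
  have h3 := IsEigenvalueMatrix.sum (s := Finset.univ) fun j _ =>
    (isEigenvalueMatrix_thetaBlocks h hc hAC (Subalgebra.zero_mem _) (hF j)).smul (b j)
  refine h1.unique_left hW.1 hW.schurInv ?_
  convert h2.add h3 using 1
  rw [dualBlocks_sum, smul_add, Finset.smul_sum, Finset.smul_sum]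
  simp_rw [smul_comm (Fintype.card V : ℂ)]

lemma thetaBlocks_hadamard (h : IsInvertibleJonesPair A B) (hc : ∀ i, c i ≠ 0)
    (hAC : ∀ i j, A j i * c i ^ 2 = A i j * c j ^ 2) {E F E' F' : Matrix V V ℂ}
    (hE : E ∈ nomura A) (hF : F ∈ nomura₂ A B) (hE' : E' ∈ nomura A) (hF' : F' ∈ nomura₂ A B)
    (hFF' : F * F' = F' * F) :
    thetaBlocks A B c E F ⊙ thetaBlocks A B c E' F' = thetaBlocks A B c (E * E') (F * F') := by
  have hA := h.isTypeII_left
  have hB := h.isTypeII_right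
  have hc2 : ∀ i, (c ^ 2) i ≠ 0 := fun i => pow_ne_zero 2 (hc i)
  have e1 : Theta A E ⊙ Theta A E' = Theta A (E * E') := Theta₂_mul hA.1 hA.schurInv.1 hE hE'
  have e2 : Theta B E ⊙ Theta B E' = Theta B (E * E') := Theta₂_mul hB.1 hB.schurInv.1
    (h.nomura_eq ▸ hE : E ∈ nomura B) (h.nomura_eq ▸ hE' : E' ∈ nomura B)
  have e3 := Theta₂_mul hA.1 hB.1 hF hF'
  have e4 := Theta₂_mul hA.1 hB.1 (h.twist_mem hc hAC hF) (h.twist_mem hc hAC hF')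
  -- The twist reverses products, hence the commutation hypothesis.
  rw [twist_mul hc2, ← hFF'] at e4
  rw [thetaBlocks, thetaBlocks, thetaBlocks, ← e1, ← e2, ← e3, ← e4]
  ext s t
  rcases s with s | s <;> rcases t with t | t <;> simp

lemma thetaBlocks_zero_zero (hA : IsTypeII A) (hB : IsTypeII B) :
    thetaBlocks A B c 0 0 = 0 := by
  rw [thetaBlocks, twist_zero, Theta, Theta, Theta₂_zero hA.1 hA.schurInv.1,
    Theta₂_zero hB.1 hB.schurInv.1, Theta₂_zero hA.1 hB.1]
  simp

lemma thetaBlocks_one_one (hA : IsTypeII A) (hB : IsTypeII B) (hc : ∀ i, c i ≠ 0) :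
    thetaBlocks A B c 1 1 = Matrix.of fun _ _ => 1 := by
  have hc2 : ∀ i, (c ^ 2) i ≠ 0 := fun i => pow_ne_zero 2 (hc i)
  rw [thetaBlocks, twist_one hc2, Theta, Theta, Theta₂_one hA.1 hA.schurInv.1,
    Theta₂_one hB.1 hB.schurInv.1, Theta₂_one hA.1 hB.1]
  ext s t
  rcases s with s | s <;> rcases t with t | t <;> simp

lemma thetaBlocks_ne_zero (h : IsInvertibleJonesPair A B) (hc : ∀ i, c i ≠ 0)
    (hAC : ∀ i j, A j i * c i ^ 2 = A i j * c j ^ 2) {E F : Matrix V V ℂ}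
    (hE : E ∈ nomura A) (hF : F ∈ nomura₂ A B) (h0 : E ≠ 0 ∨ F ≠ 0) :
    thetaBlocks A B c E F ≠ 0 := by
  intro hz
  have hW := isTypeII_matrixW h.isTypeII_left h.isTypeII_right hc
  have h1 := isEigenvalueMatrix_thetaBlocks h hc hAC hE hF
  rw [hz] at h1
  have h2 := h1.unique hW.1 hW.schurInv.1 .zero
  have h3 : dualBlocks c E F = 0 := by
    ext s t
    have hn : (Fintype.card V : ℂ) ≠ 0 := card_ne_zero_of_mem (Sum.elim id id s)
    have := congrFun (congrFun h2 s) t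
    simpa [hn] using this
  obtain ⟨hE0, hF0⟩ := dualBlocks_eq_zero hc h3
  exact h0.elim (absurd hE0) (absurd hF0)

theorem isSchurIdempotentBasis_thetaBlocks (h : IsInvertibleJonesPair A B)
    (hc : ∀ i, c i ≠ 0) (hAC : ∀ i j, A j i * c i ^ 2 = A i j * c j ^ 2) {κ κ' : Type*}
    [Fintype κ] [Fintype κ'] {E : κ → Matrix V V ℂ} {F : κ' → Matrix V V ℂ}
    (hE : IsPrincipalIdempotentBasis (nomura A) E)
    (hF : IsPrincipalIdempotentBasis (nomura₂ A B) F) :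
    IsSchurIdempotentBasis (nomura (matrixW A B (Matrix.diagonal c)))
      (Sum.elim (fun i => thetaBlocks A B c (E i) 0) (fun j => thetaBlocks A B c 0 (F j))) := by
  have hA := h.isTypeII_left
  have hB := h.isTypeII_right
  have hE0 : (0 : Matrix V V ℂ) ∈ nomura A := Subalgebra.zero_mem _
  have hF0 : (0 : Matrix V V ℂ) ∈ nomura₂ A B := Subalgebra.zero_mem _
  have hFc : ∀ i j, F i * F j = F j * F i := fun i j => by
    by_cases hij : i = j
    · rw [hij]
    · rw [hF.2.2.2.1 i j hij, hF.2.2.2.1 j i (Ne.symm hij)]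
  refine .of_span ?_ (le_antisymm ?_ ?_) ?_ ?_ ?_
  · rintro (i | j)
    · exact thetaBlocks_ne_zero h hc hAC (hE.mem i) hF0 (.inl (hE.1.ne_zero i))
    · exact thetaBlocks_ne_zero h hc hAC hE0 (hF.mem j) (.inr (hF.1.ne_zero j))
  · rw [Submodule.span_le]
    rintro _ ⟨i | j, rfl⟩
    · exact ⟨_, isEigenvalueMatrix_thetaBlocks h hc hAC (hE.mem i) hF0⟩
    · exact ⟨_, isEigenvalueMatrix_thetaBlocks h hc hAC hE0 (hF.mem j)⟩
  · rintro M ⟨S, hS⟩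
    obtain ⟨E', hE', F', hF', rfl, -⟩ := exists_of_isEigenvalueMatrix_matrixW h hc hAC hS
    obtain ⟨a, rfl⟩ := hE.exists_eq_sum hE'
    obtain ⟨b, rfl⟩ := hF.exists_eq_sum hF'
    rw [thetaBlocks_sum h hc hAC a b hE.mem hF.mem]
    exact add_mem
      (Submodule.sum_mem _ fun i _ =>
        Submodule.smul_mem _ _ (Submodule.subset_span ⟨.inl i, rfl⟩))
      (Submodule.sum_mem _ fun j _ =>
        Submodule.smul_mem _ _ (Submodule.subset_span ⟨.inr j, rfl⟩))
  · rintro (i | j) <;> simp only [Sum.elim_inl, Sum.elim_inr]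
    · rw [thetaBlocks_hadamard h hc hAC (hE.mem i) hF0 (hE.mem i) hF0 rfl, hE.2.2.1, mul_zero]
    · rw [thetaBlocks_hadamard h hc hAC hE0 (hF.mem j) hE0 (hF.mem j) rfl, hF.2.2.1, mul_zero]
  · rintro (i | i) (j | j) hij <;> simp only [Sum.elim_inl, Sum.elim_inr]
    · rw [thetaBlocks_hadamard h hc hAC (hE.mem i) hF0 (hE.mem j) hF0 rfl,
        hE.2.2.2.1 i j fun e => hij (congrArg _ e), mul_zero, thetaBlocks_zero_zero hA hB]
    · rw [thetaBlocks_hadamard h hc hAC (hE.mem i) hF0 hE0 (hF.mem j) (by simp), mul_zero,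
        zero_mul, thetaBlocks_zero_zero hA hB]
    · rw [thetaBlocks_hadamard h hc hAC hE0 (hF.mem i) (hE.mem j) hF0 (by simp), mul_zero,
        zero_mul, thetaBlocks_zero_zero hA hB]
    · rw [thetaBlocks_hadamard h hc hAC hE0 (hF.mem i) hE0 (hF.mem j) (hFc i j),
        hF.2.2.2.1 i j fun e => hij (congrArg _ e), mul_zero, thetaBlocks_zero_zero hA hB]
  · have := thetaBlocks_sum h hc hAC (fun _ => 1) (fun _ => 1) hE.mem hF.mem
    simp only [one_smul] at this
    rw [Fintype.sum_sum_type]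
    simp only [Sum.elim_inl, Sum.elim_inr]
    rw [← this, hE.2.2.2.2, hF.2.2.2.2, thetaBlocks_one_one hA hB hc]

lemma dualBlocks_mem (h : IsInvertibleJonesPair A B) (hc : ∀ i, c i ≠ 0)
    (hAC : ∀ i j, A j i * c i ^ 2 = A i j * c j ^ 2) {E F : Matrix V V ℂ}
    (hE : E ∈ nomura A) (hF : F ∈ nomura₂ A B) :
    dualBlocks c E F ∈ nomura (matrixW A B (Matrix.diagonal c))ᵀ := by
  have hW := isTypeII_matrixW h.isTypeII_left h.isTypeII_right hc
  have h1 := (isEigenvalueMatrix_nomura_iff hW).1 (isEigenvalueMatrix_thetaBlocks h hc hAC hE hF)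
  have h2 : dualBlocks c E F
      = (Fintype.card V : ℂ)⁻¹ • (Fintype.card V : ℂ) • dualBlocks c E F := by
    ext s t
    have hn : (Fintype.card V : ℂ) ≠ 0 := card_ne_zero_of_mem (Sum.elim id id s)
    simp [hn]
  rw [h2]
  exact ⟨_, h1.smul _⟩

/-- By Nomura duality every element of N_{Wᵀ} is the eigenvalue matrix of an element of N_W. -/
lemma exists_of_mem_nomura_transpose (h : IsInvertibleJonesPair A B) (hc : ∀ i, c i ≠ 0)
    (hAC : ∀ i j, A j i * c i ^ 2 = A i j * c j ^ 2) {R : Matrix (V ⊕ V) (V ⊕ V) ℂ}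
    (hR : R ∈ nomura (matrixW A B (Matrix.diagonal c))ᵀ) :
    ∃ E ∈ nomura A, ∃ F ∈ nomura₂ A B, R = (Fintype.card V : ℂ) • dualBlocks c E F := by
  have hW := isTypeII_matrixW h.isTypeII_left h.isTypeII_right hc
  obtain ⟨S, hS⟩ := hR
  have hS' : S = (Fintype.card (V ⊕ V) : ℂ) • ((Fintype.card (V ⊕ V) : ℂ)⁻¹ • Sᵀ)ᵀ := by
    ext s t
    simp only [Matrix.smul_apply, Matrix.transpose_apply, smul_eq_mul,
      mul_inv_cancel_left₀ (card_ne_zero_of_mem s)]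
  rw [hS'] at hS
  obtain ⟨E, hE, F, hF, -, h2⟩ := exists_of_isEigenvalueMatrix_matrixW h hc hAC
    ((isEigenvalueMatrix_nomura_iff hW).2 hS)
  exact ⟨E, hE, F, hF, h2⟩

theorem isPrincipalIdempotentBasis_dualBlocks (h : IsInvertibleJonesPair A B)
    (hc : ∀ i, c i ≠ 0) (hAC : ∀ i j, A j i * c i ^ 2 = A i j * c j ^ 2) {κ κ' : Type*}
    [Fintype κ] [Fintype κ'] {E : κ → Matrix V V ℂ} {F : κ' → Matrix V V ℂ}
    (hE : IsPrincipalIdempotentBasis (nomura A) E)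
    (hF : IsPrincipalIdempotentBasis (nomura₂ A B) F) :
    IsPrincipalIdempotentBasis (nomura (matrixW A B (Matrix.diagonal c))ᵀ)
      (Sum.elim (fun i => (1 / 2 : ℂ) • dualBlocks c (E i) 0)
        (fun j => (1 / 2 : ℂ) • dualBlocks c 0 (F j))) := by
  have hE0 : (0 : Matrix V V ℂ) ∈ nomura A := Subalgebra.zero_mem _
  have hF0 : (0 : Matrix V V ℂ) ∈ nomura₂ A B := Subalgebra.zero_mem _
  have h2 : (1 / 2 : ℂ) ≠ 0 := by norm_num
  have h00 : dualBlocks c (0 : Matrix V V ℂ) 0 = 0 := by simp [dualBlocks]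
  have hmul : ∀ E F E' F' : Matrix V V ℂ,
      ((1 / 2 : ℂ) • dualBlocks c E F) * ((1 / 2 : ℂ) • dualBlocks c E' F')
        = (1 / 2 : ℂ) • dualBlocks c (E' * E) (F' * F) := by
    intro E F E' F'
    rw [Matrix.smul_mul, Matrix.mul_smul, dualBlocks_mul hc, smul_smul, smul_smul]
    norm_num
  refine .of_span ?_ (le_antisymm ?_ ?_) ?_ ?_ ?_
  · rintro (i | j)
    · exact smul_ne_zero h2 fun e => hE.1.ne_zero i (dualBlocks_eq_zero hc e).1
    · exact smul_ne_zero h2 fun e => hF.1.ne_zero j (dualBlocks_eq_zero hc e).2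
  · rw [Submodule.span_le]
    rintro _ ⟨i | j, rfl⟩
    · exact Subalgebra.smul_mem _ (dualBlocks_mem h hc hAC (hE.mem i) hF0) _
    · exact Subalgebra.smul_mem _ (dualBlocks_mem h hc hAC hE0 (hF.mem j)) _
  · intro R hR
    obtain ⟨E', hE', F', hF', rfl⟩ := exists_of_mem_nomura_transpose h hc hAC hR
    obtain ⟨a, rfl⟩ := hE.exists_eq_sum hE'
    obtain ⟨b, rfl⟩ := hF.exists_eq_sum hF'
    have hhalf : ∀ M ∈ Set.range (Sum.elim (fun i => (1 / 2 : ℂ) • dualBlocks c (E i) 0)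
        (fun j => (1 / 2 : ℂ) • dualBlocks c 0 (F j))), (2 : ℂ) • M ∈ Submodule.span ℂ
        (Set.range (Sum.elim (fun i => (1 / 2 : ℂ) • dualBlocks c (E i) 0)
          (fun j => (1 / 2 : ℂ) • dualBlocks c 0 (F j)))) := fun M hM =>
      Submodule.smul_mem _ _ (Submodule.subset_span hM)
    rw [dualBlocks_sum]
    refine Submodule.smul_mem _ _ (add_mem
      (Submodule.sum_mem _ fun i _ => Submodule.smul_mem _ _ ?_)
      (Submodule.sum_mem _ fun j _ => Submodule.smul_mem _ _ ?_))
    · simpa using hhalf _ ⟨.inl i, rfl⟩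
    · simpa using hhalf _ ⟨.inr j, rfl⟩
  · rintro (i | j) <;> simp only [Sum.elim_inl, Sum.elim_inr]
    · rw [hmul, hE.2.2.1, mul_zero]
    · rw [hmul, hF.2.2.1, mul_zero]
  · rintro (i | i) (j | j) hij <;> simp only [Sum.elim_inl, Sum.elim_inr]
    · rw [hmul, hE.2.2.2.1 j i fun e => hij (congrArg _ e.symm), mul_zero, h00, smul_zero]
    · rw [hmul, mul_zero, zero_mul, h00, smul_zero]
    · rw [hmul, mul_zero, zero_mul, h00, smul_zero]
    · rw [hmul, hF.2.2.2.1 j i fun e => hij (congrArg _ e.symm), mul_zero, h00, smul_zero]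
  · have := dualBlocks_sum (c := c) (fun _ => 1) (fun _ => 1) E F
    simp only [one_smul] at this
    rw [Fintype.sum_sum_type]
    simp only [Sum.elim_inl, Sum.elim_inr]
    rw [← Finset.smul_sum, ← Finset.smul_sum, ← smul_add, ← this, hE.2.2.2.2, hF.2.2.2.2,
      dualBlocks, twist_one hc, Matrix.transpose_one, sub_self, ← two_smul ℂ (1 : Matrix V V ℂ),
      Matrix.fromBlocks_smul, smul_smul, smul_zero]
    norm_num [Matrix.fromBlocks_one]

end BlockBases

end JonesPairs

-- The main theorem

theorem mainTheorem1 (n : ℕ) (A B C : Matrix (Fin n) (Fin n) ℂ)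
    (hAB : IsInvertibleJonesPair A B)
    (hCdiag : C.IsDiag) (hCunit : IsUnit C)
    (hAC : Aᵀ = (C ^ 2)⁻¹ * A * C ^ 2) :
    IsTypeII (matrixW A B C) ∧
    Module.finrank ℂ (nomura A) = Module.finrank ℂ (nomura₂ A B) ∧
    (∃ E : Fin (Module.finrank ℂ (nomura A)) → Matrix (Fin n) (Fin n) ℂ,
      IsPrincipalIdempotentBasis (nomura A) E) ∧
    (∃ F : Fin (Module.finrank ℂ (nomura A)) → Matrix (Fin n) (Fin n) ℂ,
      IsPrincipalIdempotentBasis (nomura₂ A B) F) ∧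
    (∀ (r : ℕ) (E F : Fin r → Matrix (Fin n) (Fin n) ℂ),
      IsPrincipalIdempotentBasis (nomura A) E →
      IsPrincipalIdempotentBasis (nomura₂ A B) F →
      IsSchurIdempotentBasis (nomura (matrixW A B C))
        (Sum.elim
          (fun i : Fin r =>
            Matrix.fromBlocks (Theta A (E i)) 0 0 (Theta B (E i))ᵀ)
          (fun j : Fin r =>
            Matrix.fromBlocks 0 (Theta₂ A B (F j))
              (Theta₂ A B (C ^ 2 * (F j)ᵀ * (C ^ 2)⁻¹))ᵀ 0)) ∧
      IsPrincipalIdempotentBasis (nomura (matrixW A B C)ᵀ)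
        (Sum.elim
          (fun i : Fin r =>
            (1 / 2 : ℂ) • Matrix.fromBlocks (E i)ᵀ (E i)ᵀ (E i)ᵀ (E i)ᵀ)
          (fun j : Fin r =>
            (1 / 2 : ℂ) • Matrix.fromBlocks
              (C * (F j)ᵀ * C⁻¹) (-(C * (F j)ᵀ * C⁻¹))
              (-(C * (F j)ᵀ * C⁻¹)) (C * (F j)ᵀ * C⁻¹)))) ∧
    Module.finrank ℂ (nomura (matrixW A B C)) = 2 * Module.finrank ℂ (nomura A) ∧
    Module.finrank ℂ (nomura (matrixW A B C)ᵀ) = 2 * Module.finrank ℂ (nomura A) := by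
  obtain ⟨c, rfl⟩ : ∃ c, C = Matrix.diagonal c := ⟨_, hCdiag.diagonal_diag.symm⟩
  have hc : ∀ i, c i ≠ 0 := fun i =>
    (Pi.isUnit_iff.1 (Matrix.isUnit_diagonal.1 hCunit) i).ne_zero
  have hc2 : ∀ i, (c ^ 2) i ≠ 0 := fun i => pow_ne_zero 2 (hc i)
  have hA := hAB.isTypeII_left
  have hB := hAB.isTypeII_right
  have hAC' : ∀ i j, A j i * c i ^ 2 = A i j * c j ^ 2 := by
    intro i j
    have hdet : IsUnit (Matrix.diagonal c ^ 2).det :=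
      (Matrix.isUnit_iff_isUnit_det _).1 (hCunit.pow 2)
    have h1 : Matrix.diagonal c ^ 2 * Aᵀ = A * Matrix.diagonal c ^ 2 := by
      rw [hAC, ← Matrix.mul_assoc, ← Matrix.mul_assoc, Matrix.mul_nonsing_inv _ hdet,
        Matrix.one_mul]
    rw [Matrix.diagonal_pow] at h1
    have h2 := congrFun (congrFun h1 i) j
    rw [Matrix.diagonal_mul, Matrix.mul_diagonal] at h2
    simpa [mul_comm] using h2
  have hdim : Module.finrank ℂ (nomura A) = Module.finrank ℂ (nomura₂ A B) :=
    hAB.nomura₂EquivNomura.finrank_eq.symm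
  have hE : ∃ E : Fin (Module.finrank ℂ (nomura A)) → Matrix (Fin n) (Fin n) ℂ,
      IsPrincipalIdempotentBasis (nomura A) E :=
    exists_isPrincipalIdempotentBasis_nomura₂ hA.1 hA.schurInv
  have hF : ∃ F : Fin (Module.finrank ℂ (nomura A)) → Matrix (Fin n) (Fin n) ℂ,
      IsPrincipalIdempotentBasis (nomura₂ A B) F := by
    rw [hdim]
    exact exists_isPrincipalIdempotentBasis_nomura₂ hA.1 hB
  refine ⟨isTypeII_matrixW hA hB hc, hdim, hE, hF, fun r E F hE hF => ⟨?_, ?_⟩, ?_, ?_⟩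
  · convert isSchurIdempotentBasis_thetaBlocks hAB hc hAC' hE hF using 3 with i j
    · rw [thetaBlocks, twist_zero, Theta₂_zero hA.1 hB.1, Matrix.transpose_zero]
    · rw [thetaBlocks, Theta, Theta, Theta₂_zero hA.1 hA.schurInv.1,
        Theta₂_zero hB.1 hB.schurInv.1, Matrix.transpose_zero, Matrix.diagonal_pow,
        diagonal_mul_transpose_mul_inv hc2]
  · convert isPrincipalIdempotentBasis_dualBlocks hAB hc hAC' hE hF using 4 with i j
    · simp [dualBlocks]
    · simp [dualBlocks, diagonal_mul_transpose_mul_inv hc]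
  · obtain ⟨E, hE⟩ := hE
    obtain ⟨F, hF⟩ := hF
    rw [(isSchurIdempotentBasis_thetaBlocks hAB hc hAC' hE hF).finrank_eq, Fintype.card_sum,
      Fintype.card_fin, two_mul]
  · obtain ⟨E, hE⟩ := hE
    obtain ⟨F, hF⟩ := hF
    rw [(isPrincipalIdempotentBasis_dualBlocks hAB hc hAC' hE hF).finrank_eq, Fintype.card_sum,
      Fintype.card_fin, two_mul]
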